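/- For a non-negative real $n\times n$ matrix $A=(a_{i,j})$ let $\mathrm{perm}(A)=\sum_{\sigma\in S_n}\prod_{i}a_{i,\sigma(i)}$ be its permanent. For an integer $M\ge 1$ let $\tilde\Phi_M$ be the set of all families $\tilde P=(\tilde P^{(i,j)})_{1\le i,j\le n}$ of $M\times M$ permutation matrices, and let $A^{\uparrow\tilde P}$ be the $(Mn)\times(Mn)$ block matrix whose $(i,j)$ block is $a_{i,j}\tilde P^{(i,j)}$. The degree-$M$ Bethe permanent of $A$ is $$\mathrm{perm}_{\mathrm B,M}(A)=\Bigl(\frac{1}{|\tilde\Phi_M|}\sum_{\tilde P\in\tilde\Phi_M}\mathrm{perm}\bigl(A^{\uparrow\tilde P}\bigr)\Bigr)^{1/M}.$$ The Bethe permanent $\mathrm{perm}_{\mathrm B}(A)$ is the Bethe approximation of the partition function of the following normal factor graph. Its graph is the complete bipartite graph with left function nodes $1,\dots,n$ and right function nodes $1,\dots,n$; each edge $(i,j)$ carries a variable $x_{i,j}\in\{0,1\}$; with $e_k\in\{0,1\}^n$ the $k$-th unit vector, the local functions are $f_{\mathrm L,i}(e_j)=\sqrt{a_{i,j}}$ and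 $f_{\mathrm R,j}(e_i)=\sqrt{a_{i,j}}$, and both are $0$ at all other points of $\{0,1\}^n$; here the arguments of $f_{\mathrm L,i}$ are $x_{i,1},\dots,x_{i,n}$ and those of $f_{\mathrm R,j}$ are $x_{1,j},\dots,x_{n,j}$. Explicitly, $\mathrm{perm}_{\mathrm B}(A)=\exp(-\min F)$, where $F$ is the Bethe free energy $$F=-\sum_{i}\sum_x b_{\mathrm L,i}(x)\log f_{\mathrm L,i}(x)-\sum_j\sum_x b_{\mathrm R,j}(x)\log f_{\mathrm R,j}(x)-\Bigl(\sum_i H(b_{\mathrm L,i})+\sum_j H(b_{\mathrm R,j})-\sum_{i,j}H(b_{i,j})\Bigr),$$ $H$ is the Shannon entropy (natural logarithm, $0\log 0=0$), and the minimum is over all families of probability mass functions $b_{\mathrm L,i},b_{\mathrm R,j}$ on $\{0,1\}^n$ that vanish where $f_{\mathrm L,i}$, respectively $f_{\mathrm R,j}$, vanishes and that are consistent on edges: for all $i,j$ the marginal of $b_{\mathrm L,i}$ in its $j$-th argument equals the marginal of $b_{\mathrm R,j}$ in its $i$-th argument; $b_{i,j}$ denotes this common marginal. (If no such family exists, $\mathrm{perm}_{\mathrm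 B}(A)=0$.) **Theorem.** Let $A=\mathbf 1_{n\times n}$ be the all-one matrix of size $n\times n$. Then, as $n\to\infty$, $$\frac{\mathrm{perm}(A)}{\mathrm{perm}_{\mathrm B}(A)}\sim\sqrt{\frac{2\pi n}{e}},\qquad \frac{\mathrm{perm}(A)}{\mathrm{perm}_{\mathrm B,2}(A)}\sim\sqrt[4]{\frac{\pi n}{e}},\qquad \frac{\mathrm{perm}_{\mathrm B,2}(A)}{\mathrm{perm}_{\mathrm B}(A)}\sim\sqrt2\cdot\sqrt[4]{\frac{\pi n}{e}},$$ where $a(n)\sim b(n)$ means $\lim_{n\to\infty}a(n)/b(n)=1$. -/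

import Mathlib

open Filter Asymptotics

namespace BethePermanent

noncomputable section

/-- The all-one matrix of size `n × n`. -/
def allOne (n : ℕ) : Matrix (Fin n) (Fin n) ℝ := Matrix.of fun _ _ => 1

/-! ### Finite graph covers and the degree-`M` Bethe permanent -/

/-- The `(Mn) × (Mn)` block matrix whose `(i, j)` block is `a i j` times the `M × M` permutation
matrix of `P i j`. -/
def coverMatrix {n M : ℕ} (A : Matrix (Fin n) (Fin n) ℝ) (P : Fin n → Fin n → Equiv.Perm (Fin M)) :
    Matrix (Fin n × Fin M) (Fin n × Fin M) ℝ :=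
  Matrix.of fun r s => A r.1 s.1 * (P r.1 s.1).permMatrix ℝ r.2 s.2

/-- The arithmetic average of the permanents of all `M`-covers of `A`. -/
def coverAverage {n : ℕ} (M : ℕ) (A : Matrix (Fin n) (Fin n) ℝ) : ℝ :=
  (∑ P : Fin n → Fin n → Equiv.Perm (Fin M), (coverMatrix A P).permanent) /
    (Fintype.card (Fin n → Fin n → Equiv.Perm (Fin M)) : ℝ)

/-- The degree-`M` Bethe permanent (`M ≥ 1`): the `M`-th root of the average over all
`M`-covers. -/
def permBetheDeg {n : ℕ} (M : ℕ) (A : Matrix (Fin n) (Fin n) ℝ) : ℝ :=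
  (coverAverage M A) ^ (1 / (M : ℝ))

/-! ### The Bethe approximation of a normal factor graph -/

/-- A normal factor graph on the complete bipartite graph with `n` left and `n` right function
nodes and a binary variable on each edge `(i, j)`: the local function `fL i` has the arguments
`x i 1, …, x i n`, and the local function `fR j` has the arguments `x 1 j, …, x n j`. -/
structure NFG (n : ℕ) where
  fL : Fin n → (Fin n → Bool) → ℝ
  fR : Fin n → (Fin n → Bool) → ℝ

/-- A family of beliefs (one function per function node). -/
structure Beliefs (n : ℕ) where
  bL : Fin n → (Fin n → Bool) → ℝ
  bR : Fin n → (Fin n → Bool) → ℝ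

/-- The marginal at coordinate `k` of a function on `{0,1}ⁿ`. -/
def marginal {n : ℕ} (b : (Fin n → Bool) → ℝ) (k : Fin n) (t : Bool) : ℝ :=
  ∑ x : Fin n → Bool, if x k = t then b x else 0

/-- `b` is a probability mass function that vanishes where the local function `f` does. -/
def IsBelief {n : ℕ} (f b : (Fin n → Bool) → ℝ) : Prop :=
  (∀ x, 0 ≤ b x) ∧ ∑ x, b x = 1 ∧ ∀ x, f x = 0 → b x = 0

/-- The local marginal polytope: the beliefs of the two function nodes at the ends of each edge
induce the same marginal on the variable of that edge. -/
def localMarginalPolytope {n : ℕ} (N : NFG n) : Set (Beliefs n) :=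
  {b | (∀ i, IsBelief (N.fL i) (b.bL i)) ∧ (∀ j, IsBelief (N.fR j) (b.bR j)) ∧
    ∀ i j t, marginal (b.bL i) j t = marginal (b.bR j) i t}

/-- The Bethe average energy `- ∑_f ∑_x b_f(x) log f(x)`. -/
def betheEnergy {n : ℕ} (N : NFG n) (b : Beliefs n) : ℝ :=
  -(∑ i, ∑ x, b.bL i x * Real.log (N.fL i x)) - ∑ j, ∑ x, b.bR j x * Real.log (N.fR j x)

/-- The Bethe entropy: the sum of the entropies of the beliefs of all function nodes minus the
sum of the entropies of the beliefs of all edges (where `0 log 0 = 0`). -/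
def betheEntropy {n : ℕ} (b : Beliefs n) : ℝ :=
  (∑ i, ∑ x, Real.negMulLog (b.bL i x)) + (∑ j, ∑ x, Real.negMulLog (b.bR j x)) -
    ∑ i, ∑ j, ∑ t, Real.negMulLog (marginal (b.bL i) j t)

/-- The Bethe free energy. -/
def betheFreeEnergy {n : ℕ} (N : NFG n) (b : Beliefs n) : ℝ :=
  betheEnergy N b - betheEntropy b

/-- The Bethe approximation of the partition function, `exp (- min F)` with `F` the Bethe free
energy, written as the supremum of `exp (- F)` over the local marginal polytope (it is `0` if
the polytope is empty). -/
def bethePartition {n : ℕ} (N : NFG n) : ℝ :=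
  sSup ((fun b => Real.exp (-betheFreeEnergy N b)) '' localMarginalPolytope N)

/-- The configuration with a single one, at position `k`. -/
def unitConfig {n : ℕ} (k : Fin n) : Fin n → Bool := fun l => decide (l = k)

/-- The normal factor graph of the matrix `A`: `fL i` takes the value `√(a i j)` at the `j`-th
unit configuration and `fR j` takes the value `√(a i j)` at the `i`-th unit configuration (at
most one term of each sum is nonzero); both vanish at all other configurations. -/
def nfgOfMatrix {n : ℕ} (A : Matrix (Fin n) (Fin n) ℝ) : NFG n where
  fL i x := ∑ j, if x = unitConfig j then Real.sqrt (A i j) else 0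
  fR j x := ∑ i, if x = unitConfig i then Real.sqrt (A i j) else 0

/-- The Bethe permanent of a non-negative matrix. -/
def permBethe {n : ℕ} (A : Matrix (Fin n) (Fin n) ℝ) : ℝ :=
  bethePartition (nfgOfMatrix A)

end

end BethePermanent

namespace BethePermanent

open Topology

/-! Bethe permanent: beliefs live on unit configurations, so a point of the polytope is a doubly
stochastic matrix `p`, and `-F` is the sum of `edgeEntropy (p i j)` (`neg_betheFreeEnergy_eq`).
Although `edgeEntropy` is not concave on `[0, 1]`, its tangent at `1/n` dominates it once `n ≥ 8`.
Hence the uniform matrix is optimal and `-min F = n log n + n(n-1) log(1 - 1/n)`, to be compared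
with Stirling's formula for `n!`.

Degree 2: exchange the sum over covers with the sum over permutations `σ` of `Fin n × Fin 2`. In a
uniformly random cover, the two entries that `σ` selects in column pair `j` are both 1 with
probability 1/2 if they lie in one block and 1/4 otherwise, independently over `j`. Expanding `∏
(1/4)(1 + indicator)` over subsets leaves a count of permutations that send prescribed pairs to
pairs (`card_mapsToPair`). After division by `n!²` the average is `∑ k, (1/2)^k / k! * centralProb
(n - k)`, which is asymptotic to `√e / √(πn)` by dominated convergence. The third ratio is the
quotient of the first two. -/

/-! ### The entropy of one edge and its tangent bound -/

/-- The entropy-like contribution of one entry of a doubly stochastic matrix to the Bethe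
entropy. -/
noncomputable def edgeEntropy (p : ℝ) : ℝ := Real.negMulLog p - Real.negMulLog (1 - p)

lemma edgeEntropy_one_sub (p : ℝ) : edgeEntropy (1 - p) = -edgeEntropy p := by
  simp [edgeEntropy]

lemma hasDerivAt_edgeEntropy {p : ℝ} (h0 : p ≠ 0) (h1 : 1 - p ≠ 0) :
    HasDerivAt edgeEntropy (-Real.log p - Real.log (1 - p) - 2) p := by
  have h := (Real.hasDerivAt_negMulLog h0).sub
    ((Real.hasDerivAt_negMulLog h1).comp p ((hasDerivAt_id p).const_sub 1))
  refine h.congr_deriv ?_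
  ring

/-- The second derivative `-1/p + 1/(1-p)` changes sign at `1/2`; by antisymmetry about `1/2` the
function is convex on the other half, so Jensen's inequality is unavailable on all of `[0, 1]`. -/
lemma concaveOn_edgeEntropy : ConcaveOn ℝ (Set.Icc 0 (1 / 2)) edgeEntropy := by
  have hc : Continuous edgeEntropy := by
    unfold edgeEntropy
    have := Real.continuous_negMulLog
    fun_prop
  refine concaveOn_of_hasDerivWithinAt2_nonpos (convex_Icc _ _) hc.continuousOn
    (f' := fun p => -Real.log p - Real.log (1 - p) - 2)
    (f'' := fun p => -p⁻¹ + (1 - p)⁻¹) ?_ ?_ ?_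
  · intro x hx
    rw [interior_Icc] at hx
    exact (hasDerivAt_edgeEntropy (by linarith [hx.1]) (by linarith [hx.2])).hasDerivWithinAt
  · intro x hx
    rw [interior_Icc] at hx
    have h1 : x ≠ 0 := by linarith [hx.1]
    have h2 : 1 - x ≠ 0 := by linarith [hx.2]
    have h := ((Real.hasDerivAt_log h1).neg.sub
      ((Real.hasDerivAt_log h2).comp x ((hasDerivAt_id x).const_sub 1))).sub_const 2
    refine (h.congr_deriv ?_).hasDerivWithinAt
    ring
  · intro x hx
    rw [interior_Icc] at hx
    have : (1 - x)⁻¹ ≤ x⁻¹ := inv_anti₀ hx.1 (by linarith [hx.2])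
    linarith

lemma edgeEntropy_zero : edgeEntropy 0 = 0 := by simp [edgeEntropy]

lemma edgeEntropy_half : edgeEntropy (1 / 2) = 0 := by
  have := edgeEntropy_one_sub (1 / 2)
  norm_num at this ⊢
  linarith

lemma edgeEntropy_nonneg {p : ℝ} (h0 : 0 ≤ p) (h1 : p ≤ 1 / 2) : 0 ≤ edgeEntropy p := by
  have h := concaveOn_edgeEntropy.2 (Set.left_mem_Icc.2 (by norm_num))
    (Set.right_mem_Icc.2 (by norm_num)) (by linarith : 0 ≤ 1 - 2 * p) (by linarith : 0 ≤ 2 * p)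
    (by ring)
  simp only [edgeEntropy_zero, edgeEntropy_half, smul_eq_mul, mul_zero, add_zero,
    zero_add] at h
  rwa [show 2 * p * (1 / 2) = p by ring] at h

lemma edgeEntropy_nonpos {p : ℝ} (h0 : 1 / 2 ≤ p) (h1 : p ≤ 1) : edgeEntropy p ≤ 0 := by
  have := edgeEntropy_nonneg (p := 1 - p) (by linarith) (by linarith)
  rw [edgeEntropy_one_sub] at this
  linarith

/-- The tangent of `edgeEntropy` at a point with nonnegative slope lies above it. -/
lemma edgeEntropy_le_tangent {c p : ℝ} (hc0 : 0 < c) (hc1 : c < 1 / 2)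
    (hs : 0 ≤ -Real.log c - Real.log (1 - c) - 2) (h0 : 0 ≤ p) (h1 : p ≤ 1) :
    edgeEntropy p ≤
      edgeEntropy c + (-Real.log c - Real.log (1 - c) - 2) * (p - c) := by
  have hd := hasDerivAt_edgeEntropy (p := c) hc0.ne' (by linarith)
  set s := -Real.log c - Real.log (1 - c) - 2
  -- Right of `1/2` concavity is lost, but there the function is nonpositive while the tangent, with
  -- nonnegative value and slope at `c`, is nonnegative.
  rcases le_total (1 / 2) p with hp | hp
  · have := edgeEntropy_nonpos hp h1
    have := edgeEntropy_nonneg hc0.le hc1.le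
    have := mul_nonneg hs (by linarith : 0 ≤ p - c)
    linarith
  · rcases lt_trichotomy p c with h | rfl | h
    · have := concaveOn_edgeEntropy.le_slope_of_hasDerivAt ⟨h0, hp⟩ ⟨hc0.le, hc1.le⟩ h hd
      rw [slope_def_field, le_div_iff₀ (by linarith)] at this
      linarith
    · simp
    · have := concaveOn_edgeEntropy.slope_le_of_hasDerivAt ⟨hc0.le, hc1.le⟩ ⟨h0, hp⟩ h hd
      rw [slope_def_field, div_le_iff₀ (by linarith)] at this
      linarith

/-- The tangent at `1/n` has slope at least `log n - 2`; the threshold 8 works because `e² < 8`. -/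
lemma two_le_log_nat {n : ℕ} (hn : 8 ≤ n) : 2 ≤ Real.log n := by
  rw [Real.le_log_iff_exp_le (by positivity)]
  have h : Real.exp 2 = Real.exp 1 * Real.exp 1 := by rw [← Real.exp_add]; norm_num
  have h1 := Real.exp_one_lt_d9
  have h2 := Real.exp_pos 1
  have h3 : (8 : ℝ) ≤ n := by exact_mod_cast hn
  nlinarith

/-- The linear terms of the tangent bounds cancel, since the deviations `p j - 1/n` sum to zero. -/
lemma sum_edgeEntropy_le {n : ℕ} (hn : 8 ≤ n) (p : Fin n → ℝ) (h0 : ∀ j, 0 ≤ p j)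
    (hp : ∑ j, p j = 1) : ∑ j, edgeEntropy (p j) ≤ n * edgeEntropy (1 / n) := by
  have h3 : (8 : ℝ) ≤ n := by exact_mod_cast hn
  have hc0 : (0 : ℝ) < 1 / n := by positivity
  have hc1 : (1 : ℝ) / n < 1 / 2 := by
    rw [div_lt_div_iff₀ (by positivity) (by norm_num)]; linarith
  have hs : 0 ≤ -Real.log (1 / n : ℝ) - Real.log (1 - 1 / n) - 2 := by
    have h1 : Real.log (1 - 1 / n : ℝ) ≤ 0 := Real.log_nonpos (by linarith) (by linarith)
    have h2 := two_le_log_nat hn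
    rw [one_div, Real.log_inv, ← one_div]
    linarith
  calc ∑ j, edgeEntropy (p j)
      ≤ ∑ j, (edgeEntropy (1 / n) +
          (-Real.log (1 / n : ℝ) - Real.log (1 - 1 / n) - 2) * (p j - 1 / n)) := by
        refine Finset.sum_le_sum fun j _ => edgeEntropy_le_tangent hc0 hc1 hs (h0 j) ?_
        rw [← hp]
        exact Finset.single_le_sum (fun i _ => h0 i) (Finset.mem_univ j)
    _ = n * edgeEntropy (1 / n) := by
        rw [Finset.sum_add_distrib, ← Finset.mul_sum, Finset.sum_sub_distrib, hp]
        have : (n : ℝ) ≠ 0 := by positivity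
        simp [this]

/-! ### The Bethe permanent of the all-one matrix -/

lemma unitConfig_injective {n : ℕ} : Function.Injective (unitConfig (n := n)) := by
  intro k l h
  have := congrFun h k
  simpa [unitConfig] using this

lemma sum_eq_sum_unitConfig {n : ℕ} {g : (Fin n → Bool) → ℝ}
    (hg : ∀ x, (∀ k, x ≠ unitConfig k) → g x = 0) : ∑ x, g x = ∑ k, g (unitConfig k) := by
  rw [← Finset.sum_image (s := Finset.univ) (f := g) (g := unitConfig)
    (fun _ _ _ _ h => unitConfig_injective h)]
  refine (Finset.sum_subset (Finset.subset_univ _) fun x _ hx => hg x fun k hk => hx ?_).symm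
  exact Finset.mem_image.2 ⟨k, Finset.mem_univ k, hk.symm⟩

/-- The local function of every node in the normal factor graph of the all-one matrix. -/
noncomputable def unitIndicator {n : ℕ} (x : Fin n → Bool) : ℝ :=
  ∑ j, if x = unitConfig j then 1 else 0

lemma unitIndicator_unitConfig {n : ℕ} (k : Fin n) : unitIndicator (unitConfig k) = 1 := by
  simp [unitIndicator, unitConfig_injective.eq_iff]

lemma unitIndicator_eq_zero {n : ℕ} {x : Fin n → Bool} (hx : ∀ k, x ≠ unitConfig k) :
    unitIndicator x = 0 := by
  simp [unitIndicator, hx]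

lemma nfgOfMatrix_allOne (n : ℕ) :
    nfgOfMatrix (allOne n) = ⟨fun _ => unitIndicator, fun _ => unitIndicator⟩ := by
  simp [nfgOfMatrix, allOne, unitIndicator, funext_iff]

namespace IsBelief

variable {n : ℕ} {b : (Fin n → Bool) → ℝ} (hb : IsBelief unitIndicator b)
include hb

lemma eq_zero {x : Fin n → Bool} (hx : ∀ k, x ≠ unitConfig k) : b x = 0 :=
  hb.2.2 x (unitIndicator_eq_zero hx)

lemma sum_unitConfig : ∑ k, b (unitConfig k) = 1 := by
  rw [← hb.2.1, sum_eq_sum_unitConfig fun x hx => hb.eq_zero hx]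

lemma marginal_true (k : Fin n) : marginal b k true = b (unitConfig k) := by
  rw [marginal, sum_eq_sum_unitConfig fun x hx => by simp [hb.eq_zero hx]]
  simp [unitConfig]

lemma marginal_false (k : Fin n) : marginal b k false = 1 - b (unitConfig k) := by
  rw [← hb.marginal_true, eq_sub_iff_add_eq, ← hb.2.1, marginal, marginal,
    ← Finset.sum_add_distrib]
  refine Finset.sum_congr rfl fun x _ => ?_
  cases x k <;> simp

lemma sum_negMulLog :
    ∑ x, Real.negMulLog (b x) = ∑ k, Real.negMulLog (b (unitConfig k)) :=
  sum_eq_sum_unitConfig fun x hx => by simp [hb.eq_zero hx]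

lemma sum_mul_log : ∑ x, b x * Real.log (unitIndicator x) = 0 := by
  rw [sum_eq_sum_unitConfig fun x hx => by simp [hb.eq_zero hx]]
  simp [unitIndicator_unitConfig]

end IsBelief

/-- The energy vanishes because the local functions equal 1 on their support. Edge consistency makes
the right beliefs the transpose of the left ones, so each `p i j` contributes `negMulLog p` twice,
and the edge entropy removes one copy together with `negMulLog (1 - p)`. -/
lemma neg_betheFreeEnergy_eq {n : ℕ} {b : Beliefs n}
    (hb : b ∈ localMarginalPolytope (nfgOfMatrix (allOne n))) :
    -betheFreeEnergy (nfgOfMatrix (allOne n)) b =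
      ∑ i, ∑ j, edgeEntropy (b.bL i (unitConfig j)) := by
  rw [nfgOfMatrix_allOne] at hb ⊢
  obtain ⟨hL, hR, hLR⟩ := hb
  dsimp only at hL hR
  have hE : betheEnergy ⟨fun _ => unitIndicator, fun _ => unitIndicator⟩ b = 0 := by
    simp [betheEnergy, fun i => (hL i).sum_mul_log, fun j => (hR j).sum_mul_log]
  have hT : ∀ i j, b.bR j (unitConfig i) = b.bL i (unitConfig j) := fun i j => by
    rw [← (hR j).marginal_true, ← hLR, (hL i).marginal_true]
  rw [betheFreeEnergy, hE, betheEntropy]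
  simp only [fun i => (hL i).sum_negMulLog, fun j => (hR j).sum_negMulLog, Fintype.sum_bool,
    fun i => (hL i).marginal_true, fun i => (hL i).marginal_false, hT]
  rw [Finset.sum_comm (f := fun x y => Real.negMulLog (b.bL y (unitConfig x)))]
  simp only [edgeEntropy, Finset.sum_add_distrib, Finset.sum_sub_distrib]
  ring

/-- The family of uniform beliefs on the unit configurations. -/
noncomputable def uniformBeliefs (n : ℕ) : Beliefs n where
  bL _ x := unitIndicator x / n
  bR _ x := unitIndicator x / n

lemma isBelief_uniform {n : ℕ} (hn : n ≠ 0) :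
    IsBelief unitIndicator (fun x : Fin n → Bool => unitIndicator x / n) := by
  refine ⟨fun x => ?_, ?_, fun x hx => by simp [hx]⟩
  · unfold unitIndicator
    positivity
  · rw [sum_eq_sum_unitConfig fun x hx => by simp [unitIndicator_eq_zero hx]]
    simp [unitIndicator_unitConfig, hn]

lemma uniformBeliefs_mem {n : ℕ} (hn : n ≠ 0) :
    uniformBeliefs n ∈ localMarginalPolytope (nfgOfMatrix (allOne n)) := by
  rw [nfgOfMatrix_allOne]
  have h := isBelief_uniform hn
  refine ⟨fun _ => h, fun _ => h, fun i j t => ?_⟩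
  cases t
  · exact (h.marginal_false j).trans ((h.marginal_false i).trans
      (by simp [unitIndicator_unitConfig])).symm
  · exact (h.marginal_true j).trans ((h.marginal_true i).trans
      (by simp [unitIndicator_unitConfig])).symm

/-- The upper bound uses the row sums only; the uniform beliefs attain it and also satisfy the
column constraints. -/
theorem permBethe_allOne {n : ℕ} (hn : 8 ≤ n) :
    permBethe (allOne n) = Real.exp (n * (n * edgeEntropy (1 / n))) := by
  refine IsGreatest.csSup_eq ⟨⟨uniformBeliefs n, uniformBeliefs_mem (by omega), ?_⟩, ?_⟩
  · dsimp only
    rw [neg_betheFreeEnergy_eq (uniformBeliefs_mem (by omega))]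
    simp [uniformBeliefs, unitIndicator_unitConfig]
  · rintro _ ⟨b, hb, rfl⟩
    refine Real.exp_le_exp.2 ?_
    rw [neg_betheFreeEnergy_eq hb]
    rw [nfgOfMatrix_allOne] at hb
    have hL : ∀ i, IsBelief unitIndicator (b.bL i) := hb.1
    calc ∑ i, ∑ j, edgeEntropy (b.bL i (unitConfig j))
        ≤ ∑ _i : Fin n, (n * edgeEntropy (1 / n) : ℝ) := Finset.sum_le_sum fun i _ =>
          sum_edgeEntropy_le hn _ (fun j => (hL i).1 _) (hL i).sum_unitConfig
      _ = _ := by simp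

/-! ### The average permanent over 2-covers -/

/-- Whether the permutation `σ` maps the two elements of the pair `j` to a common pair. -/
def MapsToPair {n : ℕ} (σ : Equiv.Perm (Fin n × Fin 2)) (j : Fin n) : Prop :=
  (σ (j, 0)).1 = (σ (j, 1)).1

instance {n : ℕ} (σ : Equiv.Perm (Fin n × Fin 2)) : DecidablePred (MapsToPair σ) :=
  fun _ => inferInstanceAs (Decidable (_ = _))

/-- The number of permutations extending a given injective map on a subset. -/
lemma card_perm_extending {α : Type*} [Fintype α] [DecidableEq α] {β : Type*} [Fintype β]
    (f g : β → α) (hf : f.Injective) (hg : g.Injective) :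
    Fintype.card {σ : Equiv.Perm α // ∀ x, σ (f x) = g x} =
      (Fintype.card α - Fintype.card β).factorial := by
  classical
  let e₀ : Set.range f ≃ Set.range g :=
    (Equiv.ofInjective f hf).symm.trans (Equiv.ofInjective g hg)
  have he : ∀ x, (e₀ ⟨f x, x, rfl⟩ : α) = g x := fun x => by
    simp [e₀, Equiv.ofInjective_symm_apply]
  have e₁ : {σ : Equiv.Perm α // ∀ x, σ (f x) = g x} ≃
      {σ : Equiv.Perm α // ∀ x : Set.range f, σ x = e₀ x} :=
    Equiv.subtypeEquivRight fun σ => by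
      constructor
      · rintro h ⟨_, x, rfl⟩
        rw [he, h]
      · intro h x
        rw [← he, ← h]
  have hcf : Fintype.card ((Set.range f)ᶜ : Set α) = Fintype.card α - Fintype.card β := by
    rw [Fintype.card_compl_set, Set.card_range_of_injective hf]
  have hcg : Fintype.card ((Set.range g)ᶜ : Set α) = Fintype.card α - Fintype.card β := by
    rw [Fintype.card_compl_set, Set.card_range_of_injective hg]
  -- An extension amounts to a bijection between the complements of the two ranges.
  rw [Fintype.card_congr (e₁.trans (Equiv.Set.compl e₀)),
    Fintype.card_equiv (Fintype.equivOfCardEq (hcf.trans hcg.symm)), hcf]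

/-- The restriction of a permutation that maps all pairs in `S` to pairs is given by an injection
on the pairs and a permutation for each pair. -/
lemma card_mapsToPair {n : ℕ} (S : Finset (Fin n)) :
    Fintype.card {σ : Equiv.Perm (Fin n × Fin 2) // ∀ j ∈ S, MapsToPair σ j} =
      n.descFactorial S.card * 2 ^ S.card * (2 * (n - S.card)).factorial := by
  classical
  let D := (S ↪ Fin n) × (S → Equiv.Perm (Fin 2))
  let F : D → S × Fin 2 → Fin n × Fin 2 := fun d x => (d.1 x.1, d.2 x.1 x.2)
  let ι : S × Fin 2 → Fin n × Fin 2 := fun x => (x.1, x.2)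
  have hι : ι.Injective := by
    rintro ⟨i, a⟩ ⟨j, b⟩ h
    obtain rfl : i = j := Subtype.ext (congrArg Prod.fst h)
    exact congrArg (Prod.mk i) (congrArg Prod.snd h)
  have hF : ∀ d, (F d).Injective := by
    rintro d ⟨i, a⟩ ⟨j, b⟩ h
    obtain rfl : i = j := d.1.injective (congrArg Prod.fst h)
    exact congrArg (Prod.mk i) ((d.2 i).injective (congrArg Prod.snd h))
  have hFinj : F.Injective := by
    rintro ⟨f, π⟩ ⟨f', π'⟩ h
    simp only [F, funext_iff, Prod.mk.injEq, Prod.forall] at h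
    ext i a
    · exact congrArg Fin.val (h i 0).1
    · exact congrArg Fin.val (h i a).2
  -- Partition the permutations by their restriction `d` to the pairs in `S`; all fibres have the
  -- same size.
  let G : (Σ d : D, {σ : Equiv.Perm (Fin n × Fin 2) // ∀ x, σ (ι x) = F d x}) →
      {σ : Equiv.Perm (Fin n × Fin 2) // ∀ j ∈ S, MapsToPair σ j} := fun p =>
    ⟨p.2.1, fun j hj => by
      have h0 := p.2.2 (⟨j, hj⟩, 0)
      have h1 := p.2.2 (⟨j, hj⟩, 1)
      simp only [ι] at h0 h1
      simp [MapsToPair, h0, h1, F]⟩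
  have hG : G.Bijective := by
    constructor
    · rintro ⟨d, σ, h⟩ ⟨d', σ', h'⟩ hh
      obtain rfl : σ = σ' := congrArg Subtype.val hh
      obtain rfl : d = d' := hFinj (funext fun x => (h x).symm.trans (h' x))
      rfl
    · rintro ⟨σ, hσ⟩
      have hfst : ∀ (j : S) (a : Fin 2), (σ (j, a)).1 = (σ (j, 0)).1 := fun j a => by
        have := hσ j j.2
        unfold MapsToPair at this
        fin_cases a <;> simp [this]
      have hinj : ∀ j : S, Function.Injective fun a => (σ (j, a)).2 := fun j a b h => by
        have : σ (j, a) = σ (j, b) := Prod.ext ((hfst j a).trans (hfst j b).symm) h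
        simpa using this
      -- The image of pair `j` fills its whole target pair, so a pair `k` with the same target would
      -- share a point with it.
      have hfinj : Function.Injective fun j : S => (σ (j, 0)).1 := fun j k h => by
        obtain ⟨a, ha⟩ := (Finite.injective_iff_surjective.1 (hinj j)) (σ (k, 0)).2
        have : σ (j, a) = σ (k, 0) := Prod.ext ((hfst j a).trans h) ha
        have := σ.injective this
        exact Subtype.ext (congrArg Prod.fst this)
      refine ⟨⟨⟨⟨fun j => (σ (j, 0)).1, hfinj⟩, fun j => Equiv.ofBijective _
        (Finite.injective_iff_bijective.1 (hinj j))⟩, σ, ?_⟩, rfl⟩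
      rintro ⟨j, a⟩
      exact Prod.ext (hfst j a) rfl
  rw [← Fintype.card_congr (Equiv.ofBijective G hG), Fintype.card_sigma]
  simp only [card_perm_extending ι (F _) hι (hF _)]
  have : n * 2 - S.card * 2 = 2 * (n - S.card) := by omega
  simp [D, Fintype.card_perm, this]

lemma sum_perm_fin_two_ite (a b : Fin 2) :
    ∑ π : Equiv.Perm (Fin 2), (if π b = a then 1 else 0 : ℝ) = 1 := by
  have : ∀ a b : Fin 2, (Finset.univ.filter fun π : Equiv.Perm (Fin 2) => π b = a).card = 1 := by
    decide
  rw [Finset.sum_boole, this, Nat.cast_one]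

/-- Among the `2 ^ n` families, two conditions on distinct coordinates are independent, each of
probability 1/2. On one coordinate they coincide, because a permutation of two points is determined
by one value. -/
lemma sum_ite_mul_ite {n : ℕ} (u v : Fin n × Fin 2) (huv : u ≠ v) :
    ∑ q : Fin n → Equiv.Perm (Fin 2),
      ((if q u.1 u.2 = 0 then 1 else 0 : ℝ) * (if q v.1 v.2 = 1 then 1 else 0)) =
      2 ^ n * (1 / 4 * (1 + if u.1 = v.1 then 1 else 0)) := by
  classical
  obtain ⟨k, b⟩ := u
  obtain ⟨l, c⟩ := v
  have hcard : ∑ _π : Equiv.Perm (Fin 2), (1 : ℝ) = 2 := by simp [Fintype.card_perm]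
  have key : ∀ h : Fin n → Equiv.Perm (Fin 2) → ℝ, ∀ w : Fin n → ℝ,
      (∀ m, ∑ π, h m π = 2 * w m) → ∑ q : Fin n → Equiv.Perm (Fin 2), ∏ m, h m (q m) =
        2 ^ n * ∏ m, w m := fun h w hw => by
    rw [← Fintype.prod_sum, Finset.prod_congr rfl fun m _ => hw m, Finset.prod_mul_distrib]
    simp
  dsimp only
  by_cases hkl : k = l
  · subst hkl
    have hbc : b ≠ c := fun h => huv (by rw [h])
    have hiff : ∀ π : Equiv.Perm (Fin 2), π c = 1 ↔ π b = 0 := by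
      clear huv
      revert b c
      decide
    have := key (fun m π => if m = k then (if π b = 0 then 1 else 0) else 1)
      (fun m => if m = k then 1 / 2 else 1) fun m => by
        by_cases hm : m = k
        · simp only [hm, if_true, sum_perm_fin_two_ite]; norm_num
        · simp only [hm, if_false, hcard, mul_one]
    simp only [Finset.prod_ite_eq', Finset.mem_univ, if_true] at this
    simp only [hiff, ← ite_and, mul_ite, mul_one, mul_zero, and_self, this, if_true]
    norm_num
  · have := key (fun m π => (if m = k then (if π b = 0 then 1 else 0) else 1) *
        (if m = l then (if π c = 1 then 1 else 0) else 1))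
      (fun m => (if m = k then 1 / 2 else 1) * (if m = l then 1 / 2 else 1)) fun m => by
        by_cases hm : m = k
        · have : m ≠ l := fun h => hkl (hm.symm.trans h)
          simp only [hm, if_true, hkl, if_false, mul_one, sum_perm_fin_two_ite]; norm_num
        · by_cases hm' : m = l
          · simp only [hm', if_true, Ne.symm hkl, if_false, one_mul, sum_perm_fin_two_ite]
            norm_num
          · simp only [hm, hm', if_false, hcard, mul_one]
    simp only [Finset.prod_mul_distrib, Finset.prod_ite_eq', Finset.mem_univ, if_true] at this
    rw [this, if_neg hkl]
    norm_num

lemma sum_permanent_coverMatrix_two (n : ℕ) :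
    ∑ P : Fin n → Fin n → Equiv.Perm (Fin 2), (coverMatrix (allOne n) P).permanent =
      (2 ^ n) ^ n * ∑ σ : Equiv.Perm (Fin n × Fin 2),
        ∏ j, (1 / 4 * (1 + if MapsToPair σ j then 1 else 0 : ℝ)) := by
  simp only [Matrix.permanent]
  rw [Finset.sum_comm, Finset.mul_sum]
  refine Finset.sum_congr rfl fun σ _ => ?_
  -- Index the cover by columns first: each factor of the product over column pairs then involves
  -- only its own column of permutations, and the sum factorises.
  rw [← (Equiv.piComm fun _ _ => Equiv.Perm (Fin 2)).sum_comp]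
  simp only [Fintype.prod_prod_type, Fin.prod_univ_two, coverMatrix, allOne, Matrix.of_apply,
    one_mul, PEquiv.toMatrix_apply, Equiv.toPEquiv_apply, Option.mem_some_iff, Equiv.piComm_apply,
    Function.swap]
  rw [← Fintype.prod_sum fun j (q : Fin n → Equiv.Perm (Fin 2)) =>
    ((if q (σ (j, 0)).1 (σ (j, 0)).2 = 0 then 1 else 0 : ℝ) *
      (if q (σ (j, 1)).1 (σ (j, 1)).2 = 1 then 1 else 0))]
  rw [Finset.prod_congr rfl fun j _ => sum_ite_mul_ite (σ (j, 0)) (σ (j, 1)) (by simp),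
    Finset.prod_mul_distrib, Finset.prod_const, Finset.card_univ, Fintype.card_fin]
  rfl

theorem coverAverage_two_allOne (n : ℕ) :
    coverAverage 2 (allOne n) = (1 / 4) ^ n * ∑ k ∈ Finset.range (n + 1),
      ((n.choose k * (n.descFactorial k * 2 ^ k * (2 * (n - k)).factorial) : ℕ) : ℝ) := by
  have hcard : (Fintype.card (Fin n → Fin n → Equiv.Perm (Fin 2)) : ℝ) = (2 ^ n) ^ n := by
    simp [Fintype.card_perm]
  rw [coverAverage, sum_permanent_coverMatrix_two, hcard, mul_div_cancel_left₀ _ (by positivity)]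
  simp only [Finset.prod_mul_distrib, Finset.prod_const, Finset.card_univ, Fintype.card_fin,
    ← Finset.mul_sum, Finset.prod_one_add]
  congr 1
  rw [Finset.sum_comm]
  have : ∀ S : Finset (Fin n), ∑ σ : Equiv.Perm (Fin n × Fin 2),
      ∏ j ∈ S, (if MapsToPair σ j then 1 else 0 : ℝ) =
      ((n.descFactorial S.card * 2 ^ S.card * (2 * (n - S.card)).factorial : ℕ) : ℝ) := fun S => by
    rw [← card_mapsToPair, Fintype.card_subtype, ← Finset.sum_boole]
    refine Finset.sum_congr rfl fun σ _ => ?_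
    rw [Finset.prod_ite_zero]
    simp
  rw [Finset.sum_congr rfl fun S _ => this S, Finset.sum_powerset_apply_card
    (fun k => ((n.descFactorial k * 2 ^ k * (2 * (n - k)).factorial : ℕ) : ℝ))]
  simp

/-! ### Central binomial probabilities and the limiting series -/

/-- The central binomial coefficient, normalized to a probability. -/
noncomputable def centralProb (m : ℕ) : ℝ := m.centralBinom / 4 ^ m

lemma centralProb_pos (m : ℕ) : 0 < centralProb m := by
  have := m.centralBinom_pos
  unfold centralProb
  positivity

lemma centralProb_div_succ (m : ℕ) :
    centralProb m / centralProb (m + 1) = (2 * m + 2) / (2 * m + 1) := by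
  have h : ((m + 1 : ℕ) : ℝ) * ((m + 1).centralBinom : ℝ) = 2 * (2 * m + 1) * m.centralBinom := by
    exact_mod_cast m.succ_mul_centralBinom_succ
  have h0 : (m.centralBinom : ℝ) ≠ 0 := by exact_mod_cast m.centralBinom_ne_zero
  have h1 : ((m + 1).centralBinom : ℝ) ≠ 0 := by exact_mod_cast (m + 1).centralBinom_ne_zero
  have h2 : (2 * m + 1 : ℝ) ≠ 0 := by positivity
  push_cast at h
  rw [centralProb, centralProb, pow_succ]
  field_simp
  linarith

/-- Crude but sufficient: the factor `2 ^ k` only has to be summable against `(1/2)^k / k!`. -/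
lemma centralProb_div_add_le (m k : ℕ) : centralProb m / centralProb (m + k) ≤ 2 ^ k := by
  induction k with
  | zero => simp [(centralProb_pos m).ne']
  | succ k ih =>
    rw [← div_mul_div_cancel₀ (centralProb_pos (m + k)).ne', pow_succ]
    refine mul_le_mul ih ?_ (div_pos (centralProb_pos _) (centralProb_pos _)).le (by positivity)
    rw [← add_assoc, centralProb_div_succ, div_le_iff₀ (by positivity)]
    have : (0 : ℝ) ≤ (m + k : ℕ) := by positivity
    linarith

lemma tendsto_centralProb_div_succ :
    Tendsto (fun m => centralProb m / centralProb (m + 1)) atTop (𝓝 1) := by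
  have h : Tendsto (fun m : ℕ => 1 + 1 / ((2 * m : ℝ) + 1)) atTop (𝓝 (1 + 0)) := by
    refine tendsto_const_nhds.add (tendsto_const_nhds.div_atTop ?_)
    exact tendsto_atTop_add_const_right _ _
      (tendsto_natCast_atTop_atTop.const_mul_atTop (by norm_num))
  rw [add_zero] at h
  refine h.congr fun m => ?_
  rw [centralProb_div_succ]
  field_simp
  ring

lemma tendsto_centralProb_div_add (k : ℕ) :
    Tendsto (fun m => centralProb m / centralProb (m + k)) atTop (𝓝 1) := by
  induction k with
  | zero => simp [fun m => div_self (centralProb_pos m).ne']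
  | succ k ih =>
    have h := ih.mul (tendsto_centralProb_div_succ.comp (tendsto_add_atTop_nat k))
    rw [one_mul] at h
    refine h.congr fun m => ?_
    rw [Function.comp_apply, div_mul_div_cancel₀ (centralProb_pos _).ne', add_assoc]

lemma tendsto_sum_centralProb :
    Tendsto (fun n => ∑ k ∈ Finset.range (n + 1),
      (1 / 2 : ℝ) ^ k / k.factorial * (centralProb (n - k) / centralProb n)) atTop
      (𝓝 (Real.exp (1 / 2))) := by
  let f : ℕ → ℕ → ℝ := fun n k => if k ∈ Finset.range (n + 1) then
    (1 / 2 : ℝ) ^ k / k.factorial * (centralProb (n - k) / centralProb n) else 0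
  have hf : ∀ n, ∑' k, f n k = ∑ k ∈ Finset.range (n + 1),
      (1 / 2 : ℝ) ^ k / k.factorial * (centralProb (n - k) / centralProb n) := fun n => by
    rw [tsum_eq_sum (s := Finset.range (n + 1)) fun k hk => if_neg hk]
    exact Finset.sum_congr rfl fun k hk => if_pos hk
  have hexp : ∑' k : ℕ, (1 / 2 : ℝ) ^ k / k.factorial = Real.exp (1 / 2) := by
    rw [Real.exp_eq_exp_ℝ]
    exact (NormedSpace.expSeries_div_hasSum_exp (1 / 2 : ℝ)).tsum_eq
  rw [← hexp]
  simp only [← hf]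
  -- The dominating series is `1 ^ k / k!`, where `1 = (1/2) * 2` absorbs the growth of the ratio.
  refine tendsto_tsum_of_dominated_convergence (Real.summable_pow_div_factorial 1)
    (fun k => ?_) (Eventually.of_forall fun n k => ?_)
  -- Shifting `n` by `k` removes the truncated subtraction and the range condition.
  · rw [← tendsto_add_atTop_iff_nat k]
    have h := (tendsto_centralProb_div_add k).const_mul ((1 / 2 : ℝ) ^ k / k.factorial)
    rw [mul_one] at h
    refine h.congr fun m => ?_
    have : k ∈ Finset.range (m + k + 1) := by simp
    simp only [f, if_pos this, Nat.add_sub_cancel]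
  · simp only [f]
    split_ifs with hk
    · obtain ⟨m, rfl⟩ := Nat.exists_eq_add_of_le' (Nat.lt_succ_iff.1 (Finset.mem_range.1 hk))
      rw [Nat.add_sub_cancel, Real.norm_of_nonneg (mul_nonneg (by positivity)
        (div_pos (centralProb_pos _) (centralProb_pos _)).le)]
      calc _ ≤ (1 / 2 : ℝ) ^ k / k.factorial * 2 ^ k :=
            mul_le_mul_of_nonneg_left (centralProb_div_add_le m k) (by positivity)
        _ = _ := by rw [div_mul_eq_mul_div, ← mul_pow]; norm_num
    · rw [norm_zero]
      positivity

lemma coverAverage_two_div_factorial_sq (n : ℕ) :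
    coverAverage 2 (allOne n) / (n.factorial : ℝ) ^ 2 = centralProb n *
      ∑ k ∈ Finset.range (n + 1),
        (1 / 2 : ℝ) ^ k / k.factorial * (centralProb (n - k) / centralProb n) := by
  rw [coverAverage_two_allOne, Finset.mul_sum, Finset.mul_sum, Finset.sum_div]
  refine Finset.sum_congr rfl fun k hk => ?_
  obtain ⟨m, rfl⟩ := Nat.exists_eq_add_of_le' (Nat.lt_succ_iff.1 (Finset.mem_range.1 hk))
  rw [mul_left_comm (centralProb _), mul_div_cancel₀ _ (centralProb_pos _).ne',
    Nat.add_sub_cancel, centralProb]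
  have h1 : ((m + k).choose k : ℝ) * k.factorial * m.factorial = (m + k).factorial := by
    have := Nat.choose_mul_factorial_mul_factorial (Nat.le_add_left k m)
    rw [Nat.add_sub_cancel] at this
    exact_mod_cast this
  have h2 : (m.factorial : ℝ) * (m + k).descFactorial k = (m + k).factorial := by
    have := Nat.factorial_mul_descFactorial (Nat.le_add_left k m)
    rw [Nat.add_sub_cancel] at this
    exact_mod_cast this
  have h3 : (m.centralBinom : ℝ) * m.factorial * m.factorial = (2 * m).factorial := by
    have := Nat.choose_mul_factorial_mul_factorial (show m ≤ 2 * m by omega)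
    rw [show 2 * m - m = m by omega] at this
    rw [Nat.centralBinom_eq_two_mul_choose]
    exact_mod_cast this
  have h0 := Nat.factorial_ne_zero
  have e1 : ((m + k).choose k : ℝ) = (m + k).factorial / (m.factorial * k.factorial) := by
    rw [eq_div_iff (by simp [h0]), ← h1]; ring
  have e2 : ((m + k).descFactorial k : ℝ) = (m + k).factorial / m.factorial := by
    rw [eq_div_iff (by simp [h0]), ← h2]; ring
  push_cast
  rw [e1, e2, ← h3]
  have h0' : ∀ j : ℕ, (j.factorial : ℝ) ≠ 0 := fun j => by exact_mod_cast h0 j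
  have := h0' m
  have := h0' k
  have := h0' (m + k)
  have h4 : (4 : ℝ) ^ (m + k) = 4 ^ m * (2 ^ k * 2 ^ k) := by
    rw [pow_add, ← mul_pow]; norm_num
  rw [div_pow, div_pow, one_pow, one_pow, h4]
  field_simp

/-! ### Stirling's formula and the three ratios -/

/-- The ratio of the factorial and its Stirling approximation. -/
noncomputable def stirlingRatio (n : ℕ) : ℝ :=
  n.factorial / (√(2 * n * Real.pi) * (n / Real.exp 1) ^ n)

lemma tendsto_stirlingRatio : Tendsto stirlingRatio atTop (𝓝 1) := by
  refine (isEquivalent_iff_tendsto_one ?_).1 Stirling.factorial_isEquivalent_stirling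
  filter_upwards [eventually_gt_atTop 0] with n hn
  positivity

lemma stirlingRatio_mul {n : ℕ} (hn : 0 < n) :
    stirlingRatio n * (√(2 * n * Real.pi) * (n / Real.exp 1) ^ n) = n.factorial :=
  div_mul_cancel₀ _ (by positivity)

lemma stirlingRatio_pos {n : ℕ} (hn : 0 < n) : 0 < stirlingRatio n := by
  unfold stirlingRatio
  positivity

lemma tendsto_centralProb_mul_sqrt :
    Tendsto (fun n : ℕ => centralProb n * √(Real.pi * n)) atTop (𝓝 1) := by
  have h2 : Tendsto (fun n : ℕ => 2 * n) atTop atTop :=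
    tendsto_id.const_mul_atTop' (by norm_num)
  have h := (tendsto_stirlingRatio.comp h2).div (tendsto_stirlingRatio.pow 2) (by norm_num)
  rw [one_pow, div_one] at h
  refine h.congr' ?_
  filter_upwards [eventually_gt_atTop 0] with n hn
  have h3 : (n.centralBinom : ℝ) * n.factorial * n.factorial = (2 * n).factorial := by
    have := Nat.choose_mul_factorial_mul_factorial (show n ≤ 2 * n by omega)
    rw [show 2 * n - n = n by omega] at this
    rw [Nat.centralBinom_eq_two_mul_choose]
    exact_mod_cast this
  rw [← stirlingRatio_mul hn, ← stirlingRatio_mul (show 0 < 2 * n by omega)] at h3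
  have hs := stirlingRatio_pos hn
  have e1 : √(2 * (2 * n : ℕ) * Real.pi) = 2 * √(Real.pi * n) := by
    rw [show (2 * (2 * n : ℕ) * Real.pi : ℝ) = 2 ^ 2 * (Real.pi * n) by push_cast; ring,
      Real.sqrt_mul (by positivity), Real.sqrt_sq (by norm_num)]
  have e2 : √(2 * n * Real.pi) ^ 2 = 2 * √(Real.pi * n) ^ 2 := by
    rw [Real.sq_sqrt (by positivity), Real.sq_sqrt (by positivity)]
    ring
  have e3 : (((2 * n : ℕ) : ℝ) / Real.exp 1) ^ (2 * n) =
      4 ^ n * ((n / Real.exp 1) ^ n) ^ 2 := by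
    rw [← pow_mul, mul_comm n 2, show (4 : ℝ) = 2 ^ 2 by norm_num, ← pow_mul, ← mul_pow]
    push_cast
    ring
  rw [e1, e3] at h3
  have hr : 0 < √(Real.pi * n) := by positivity
  have hx : (0 : ℝ) < (n / Real.exp 1) ^ n := by positivity
  simp only [Function.comp_apply, Pi.div_apply, centralProb]
  rw [div_mul_eq_mul_div, div_eq_div_iff (by positivity) (by positivity)]
  generalize ((n : ℝ) / Real.exp 1) ^ n = x at *
  generalize √(Real.pi * n) = r at *
  generalize √(2 * n * Real.pi) = q at *
  -- This factor rebuilds the Stirling approximation of `(2n)!` on the left, so that `h3` applies.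
  refine mul_right_cancel₀ (b := 2 * r * x ^ 2) (by positivity) ?_
  calc stirlingRatio (2 * n) * 4 ^ n * (2 * r * x ^ 2)
      = stirlingRatio (2 * n) * (2 * r * (4 ^ n * x ^ 2)) := by ring
    _ = n.centralBinom * stirlingRatio n ^ 2 * x ^ 2 * q ^ 2 := by rw [← h3]; ring
    _ = _ := by rw [e2]; ring

lemma permanent_allOne (n : ℕ) : (allOne n).permanent = n.factorial := by
  simp [Matrix.permanent, allOne, Fintype.card_perm]

lemma permanent_div_permBetheDeg_two (n : ℕ) :
    (allOne n).permanent / permBetheDeg 2 (allOne n) =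
      (√(coverAverage 2 (allOne n) / (n.factorial : ℝ) ^ 2))⁻¹ := by
  rw [permanent_allOne, permBetheDeg, Nat.cast_ofNat, ← Real.sqrt_eq_rpow,
    Real.sqrt_div' _ (by positivity), Real.sqrt_sq (by positivity), inv_div]

theorem permanent_div_permBetheDeg_two_isEquivalent :
    (fun n : ℕ => (allOne n).permanent / permBetheDeg 2 (allOne n))
      ~[atTop] fun n : ℕ => (Real.pi * (n : ℝ) / Real.exp 1) ^ (1 / 4 : ℝ) := by
  rw [isEquivalent_iff_tendsto_one]
  swap
  · filter_upwards [eventually_gt_atTop 0] with n hn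
    positivity
  have h := ((tendsto_centralProb_mul_sqrt.mul tendsto_sum_centralProb).div_const
    (Real.exp (1 / 2))).sqrt.inv₀ (by simp)
  rw [one_mul, div_self (Real.exp_ne_zero _), Real.sqrt_one, inv_one] at h
  refine h.congr' ?_
  filter_upwards [eventually_gt_atTop 0] with n hn
  rw [Pi.div_apply, permanent_div_permBetheDeg_two, coverAverage_two_div_factorial_sq]
  have e : (Real.pi * (n : ℝ) / Real.exp 1) ^ (1 / 4 : ℝ) =
      √(√(Real.pi * n) / Real.exp (1 / 2)) := by
    rw [Real.exp_half, ← Real.sqrt_div (by positivity), Real.sqrt_eq_rpow, Real.sqrt_eq_rpow,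
      ← Real.rpow_mul (by positivity)]
    norm_num
  rw [e, div_eq_mul_inv _ √(_ / _), ← mul_inv, ← Real.sqrt_mul' _ (by positivity)]
  congr 2
  ring

/-- Since `log(1 - 1/n) = -1/n - 1/(2n²) + O(n⁻³)`, the exponent is `-1/2 + O(1/n)`. This limit
produces the `1/e` under the square root. -/
lemma tendsto_bethe_exponent :
    Tendsto (fun n : ℕ => -(n : ℝ) - n * (n - 1) * Real.log (1 - 1 / n)) atTop
      (𝓝 (-(1 / 2))) := by
  rw [tendsto_iff_norm_sub_tendsto_zero]
  have h0 : Tendsto (fun n : ℕ => (1 : ℝ) / n + 1 / n) atTop (𝓝 (0 + 0)) :=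
    tendsto_one_div_atTop_nhds_zero_nat.add tendsto_one_div_atTop_nhds_zero_nat
  rw [add_zero] at h0
  refine squeeze_zero' (Eventually.of_forall fun _ => norm_nonneg _) ?_ h0
  filter_upwards [eventually_gt_atTop 1] with n hn
  have hn1 : (1 : ℝ) < n := by exact_mod_cast hn
  have hx0 : (0 : ℝ) < 1 / n := by positivity
  have hx1 : (1 : ℝ) / n < 1 := by rw [div_lt_one (by positivity)]; exact hn1
  -- Two terms of the series are needed: the prefactor `n(n-1)` turns the remainder bound into
  -- exactly `1/n`.
  have hl := Real.abs_log_sub_add_sum_range_le (x := 1 / n) (by rwa [abs_of_pos hx0]) 2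
  rw [abs_of_pos hx0, Finset.sum_range_succ, Finset.sum_range_one] at hl
  norm_num only [Nat.cast_zero, Nat.cast_one, pow_one, zero_add, div_one] at hl
  set l := Real.log (1 - 1 / (n : ℝ))
  have hpos : (0 : ℝ) < n * (n - 1) := mul_pos (by positivity) (by linarith)
  have hl' := mul_le_mul_of_nonneg_left hl hpos.le
  rw [← abs_of_pos hpos, ← abs_mul, abs_of_pos hpos] at hl'
  have hn2 : (n : ℝ) - 1 ≠ 0 := by linarith
  have e1 : (n : ℝ) * (n - 1) * ((1 / n) ^ 3 / (1 - 1 / n)) = 1 / n := by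
    have : (1 : ℝ) - 1 / n = (n - 1) / n := by field_simp
    rw [this]
    field_simp
  have e2 : -(n : ℝ) - n * (n - 1) * l - -(1 / 2) =
      -(n * (n - 1) * (1 / n + (1 / n) ^ 2 / 2 + l)) + -(1 / n / 2) := by
    field_simp
    ring
  rw [e2, Real.norm_eq_abs]
  refine (abs_add_le _ _).trans ?_
  rw [abs_neg, abs_neg, abs_of_pos (by positivity : (0 : ℝ) < 1 / n / 2)]
  have : (1 : ℝ) / n / 2 ≤ 1 / n := by linarith
  rw [e1] at hl'
  linarith

theorem permanent_div_permBethe_isEquivalent :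
    (fun n : ℕ => (allOne n).permanent / permBethe (allOne n))
      ~[atTop] fun n : ℕ => √(2 * Real.pi * (n : ℝ) / Real.exp 1) := by
  rw [isEquivalent_iff_tendsto_one]
  swap
  · filter_upwards [eventually_gt_atTop 0] with n hn
    positivity
  have h := (tendsto_stirlingRatio.mul ((Real.continuous_exp.tendsto _).comp
    tendsto_bethe_exponent)).div_const (Real.exp (-(1 / 2)))
  rw [one_mul, div_self (Real.exp_ne_zero _)] at h
  refine h.congr' ?_
  filter_upwards [eventually_ge_atTop 8] with n hn
  have hn0 : 0 < n := by omega
  have hn0' : (0 : ℝ) < n := by exact_mod_cast hn0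
  rw [Pi.div_apply, permanent_allOne, permBethe_allOne hn, ← stirlingRatio_mul hn0]
  have e1 : ((n : ℝ) / Real.exp 1) ^ n = Real.exp (n * Real.log n - n) := by
    rw [div_pow, Real.exp_sub, mul_comm, Real.exp_mul, Real.exp_log hn0', Real.rpow_natCast,
      ← Real.exp_nat_mul, mul_one]
  have e2 : √(2 * Real.pi * (n : ℝ) / Real.exp 1) =
      √(2 * n * Real.pi) / Real.exp (1 / 2) := by
    rw [Real.exp_half, ← Real.sqrt_div (by positivity)]
    congr 2
    ring
  have e3 : (n : ℝ) * (n * edgeEntropy (1 / n)) =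
      n * Real.log n + n * (n - 1) * Real.log (1 - 1 / n) := by
    rw [edgeEntropy, Real.negMulLog, Real.negMulLog, one_div, Real.log_inv]
    field_simp
    ring
  have hq : 0 < √(2 * n * Real.pi) := by positivity
  rw [e1, e2, e3, Function.comp_apply]
  rw [show -(n : ℝ) - n * (n - 1) * Real.log (1 - 1 / n) = (n * Real.log n - n) -
    (n * Real.log n + n * (n - 1) * Real.log (1 - 1 / n)) by ring, Real.exp_sub, Real.exp_neg]
  field_simp

theorem permBetheDeg_two_div_permBethe_isEquivalent :
    (fun n : ℕ => permBetheDeg 2 (allOne n) / permBethe (allOne n))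
      ~[atTop] fun n : ℕ => √2 * (Real.pi * (n : ℝ) / Real.exp 1) ^ (1 / 4 : ℝ) := by
  refine (permanent_div_permBethe_isEquivalent.div
    permanent_div_permBetheDeg_two_isEquivalent).congr_left ?_ |>.congr_right ?_
  · refine Eventually.of_forall fun n => ?_
    have : (allOne n).permanent ≠ 0 := by
      rw [permanent_allOne]
      exact_mod_cast n.factorial_ne_zero
    simp only [Pi.div_apply]
    rw [div_div_div_cancel_left' _ _ this]
  · filter_upwards [eventually_gt_atTop 0] with n hn
    have hy : (0 : ℝ) < Real.pi * n / Real.exp 1 := by positivity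
    simp only [Pi.div_apply]
    rw [div_eq_iff (by positivity), mul_assoc √2, ← Real.rpow_add hy,
      show (2 * Real.pi * n / Real.exp 1 : ℝ) = 2 * (Real.pi * n / Real.exp 1) by ring,
      Real.sqrt_mul (by norm_num), Real.sqrt_eq_rpow (Real.pi * n / Real.exp 1)]
    norm_num

end BethePermanent

theorem theorem1 :
    ((fun n : ℕ =>
        (BethePermanent.allOne n).permanent / BethePermanent.permBethe (BethePermanent.allOne n))
      ~[atTop] fun n : ℕ => Real.sqrt (2 * Real.pi * (n : ℝ) / Real.exp 1)) ∧
    ((fun n : ℕ =>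
        (BethePermanent.allOne n).permanent /
          BethePermanent.permBetheDeg 2 (BethePermanent.allOne n))
      ~[atTop] fun n : ℕ => (Real.pi * (n : ℝ) / Real.exp 1) ^ (1 / 4 : ℝ)) ∧
    ((fun n : ℕ =>
        BethePermanent.permBetheDeg 2 (BethePermanent.allOne n) /
          BethePermanent.permBethe (BethePermanent.allOne n))
      ~[atTop] fun n : ℕ =>
        Real.sqrt 2 * (Real.pi * (n : ℝ) / Real.exp 1) ^ (1 / 4 : ℝ)) :=
  ⟨BethePermanent.permanent_div_permBethe_isEquivalent,
    BethePermanent.permanent_div_permBetheDeg_two_isEquivalent,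
    BethePermanent.permBetheDeg_two_div_permBethe_isEquivalent⟩
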